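/- Let $G$ be a finite group, let $\mathbb{Z}G$ be its integral group ring, let $\Delta(G)$ be the augmentation ideal, i.e. the kernel of the augmentation map $\varepsilon:\mathbb{Z}G\to\mathbb{Z}$, $\sum_g a_g g\mapsto\sum_g a_g$, and let $\mathcal{V}(\mathbb{Z}G)$ be the group of units $u$ of $\mathbb{Z}G$ with $\varepsilon(u)=1$. Define the Lie powers of $\Delta(G)$ by $\Delta^{(1)}(G)=\Delta(G)$ and $\Delta^{(k+1)}(G)=[\Delta(G),\Delta^{(k)}(G)]\,\mathbb{Z}G$ for $k\ge 1$, where $[A,B]$ denotes the additive subgroup generated by all $ab-ba$ with $a\in A$, $b\in B$, and put $\Delta^{(\omega)}(G)=\bigcap_{k\ge 1}\Delta^{(k)}(G)$. For a group $H$ with lower central series $\gamma_1(H)=H$, $\gamma_{n+1}(H)=[\gamma_n(H),H]$, put $\gamma_\omega(H)=\bigcap_{n\ge 1}\gamma_n(H)$. Then the following statements are equivalent: (i) $\Delta^{(\omega)}(G)=\{0\}$; (ii) $\mathcal{V}(\mathbb{Z}G)$ is residually nilpotent, i.e. $\gamma_\omega(\mathcal{V}(\mathbb{Z}G))=\{1\}$;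 (iii) $G$ is nilpotent and $p$-abelian for some prime $p$, i.e. $G$ is nilpotent and its commutator subgroup $G'$ is a $p$-group for some prime $p$ (the trivial group counts as a $p$-group). -/

import Mathlib

noncomputable section

/-- The augmentation map `ε : ℤG → ℤ`, the ring homomorphism sending every `g ∈ G` to `1`. -/
def augmentation (G : Type*) [Group G] : MonoidAlgebra ℤ G →ₐ[ℤ] ℤ :=
  MonoidAlgebra.lift ℤ ℤ G (1 : G →* ℤ)

/-- The augmentation ideal `Δ(G) = ker ε`, as an additive subgroup of `ℤG`. -/
def augmentationIdeal (G : Type*) [Group G] : Submodule ℤ (MonoidAlgebra ℤ G) :=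
  LinearMap.ker (augmentation G).toLinearMap

/-- The additive subgroup `[A, B]` generated by all Lie commutators `ab - ba` with
`a ∈ A`, `b ∈ B`. -/
def lieCommutator {R : Type*} [Ring R] (A B : Submodule ℤ R) : Submodule ℤ R :=
  Submodule.span ℤ {x | ∃ a ∈ A, ∃ b ∈ B, x = a * b - b * a}

/-- The Lie powers of the augmentation ideal, with the index shifted by one:
`lieAugmentationPower G k` is `Δ^{(k+1)}(G)`, where `Δ^{(1)}(G) = Δ(G)` and
`Δ^{(k+1)}(G) = [Δ(G), Δ^{(k)}(G)] ℤG`. -/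
def lieAugmentationPower (G : Type*) [Group G] : ℕ → Submodule ℤ (MonoidAlgebra ℤ G)
  | 0 => augmentationIdeal G
  | k + 1 => lieCommutator (augmentationIdeal G) (lieAugmentationPower G k) * ⊤

/-- `Δ^{(ω)}(G)`, the intersection of all Lie powers of the augmentation ideal. -/
def lieAugmentationResidue (G : Type*) [Group G] : Submodule ℤ (MonoidAlgebra ℤ G) :=
  ⨅ k, lieAugmentationPower G k

/-- `V(ℤG)`, the group of normalized units: units of `ℤG` of augmentation one. -/
def normalizedUnits (G : Type*) [Group G] : Subgroup (MonoidAlgebra ℤ G)ˣ :=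
  (Units.map (augmentation G : MonoidAlgebra ℤ G →* ℤ)).ker

/-- The nilpotent residue `γ_ω(H)`, the intersection of all terms of the lower central series. -/
def nilpotentResidue (H : Type*) [Group H] : Subgroup H :=
  ⨅ n, (⊤ : Subgroup H).lowerCentralSeries n

/-- A group is residually nilpotent if its nilpotent residue is trivial. -/
def IsResiduallyNilpotent (H : Type*) [Group H] : Prop :=
  nilpotentResidue H = ⊥

/-- A group is `p`-abelian, for some prime `p`, if its commutator subgroup is a `p`-group. -/
def IsPAbelian (G : Type*) [Group G] : Prop :=
  ∃ p : ℕ, p.Prime ∧ IsPGroup p (commutator G)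

end

/-! (iii) ⇒ (i): the operator `B ↦ [R, B] R` commutes with central factors up to inclusion, and its
iterates on `ℤG` contain the Lie powers. If `G' ≠ 1`, take a central `z ∈ G'` of order `p`. By
induction on `|G|` some iterate for `G/⟨z⟩` lies in the multiples of `p`, so the one for `G` lies in
`(z - 1)ℤG + pℤG`. Iterating further replaces `z - 1` by `(z - 1)^p`, which is divisible by `p`
(`exists_lieStep_iterate_le`). Repetition reaches `p^k ℤG` for every `k`, and these intersect in
zero.

(i) ⇒ (ii): `u ∈ γ_n(V)` implies `u - 1 ∈ Δ^{(n)}`, by expanding group commutators as Lie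
commutators.

(ii) ⇒ (iii): `G` embeds in `V`, so it is residually nilpotent, and being finite it is nilpotent. If
`G'` is not a `p`-group, there are an odd prime `p` and a prime `q ≠ p` whose Sylow subgroups are
nonabelian and commute with each other. Choose `h, y` in the first with commutator `c` of order `p`
and `c ∉ ⟨h⟩`, and `z, w` in the second with commutator `d` of order `q`. With `ĥ` the sum over
`⟨h⟩`, the element `a = y w (1 - c)(1 - d) ĥ` is nonzero, has square zero, and is conjugated by `hz`
to `c d a`. On `a` the element `1 - cd` acts invertibly, because `p` and `q` are coprime; hence
every `1 + ra` with `r ∈ ℤ[c, d]` is a commutator of another such unit with `hz`, and `1 + a` lies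
in `γ_ω(V)` (`eq_zero_of_isResiduallyNilpotent`). -/

open scoped commutatorElement

/-! ### Iterates of `B ↦ [R, B] R` -/

/-- The operator `B ↦ [R, B] R` on additive subgroups of a ring `R`. -/
def lieStep {R : Type*} [Ring R] (B : Submodule ℤ R) : Submodule ℤ R :=
  lieCommutator ⊤ B * ⊤

section LieStep

variable {R S : Type*} [Ring R] [Ring S]

theorem lieCommutator_mono {A A' B B' : Submodule ℤ R} (hA : A ≤ A') (hB : B ≤ B') :
    lieCommutator A B ≤ lieCommutator A' B' :=
  Submodule.span_mono fun _ ⟨a, ha, b, hb, h⟩ => ⟨a, hA ha, b, hB hb, h⟩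

theorem lieStep_mono : Monotone (lieStep : Submodule ℤ R → Submodule ℤ R) := fun _ _ h =>
  mul_le_mul' (lieCommutator_mono le_rfl h) le_rfl

theorem lieStep_le {B C : Submodule ℤ R}
    (h : ∀ a, ∀ b ∈ B, ∀ r, (a * b - b * a) * r ∈ C) : lieStep B ≤ C := by
  rw [lieStep, lieCommutator, ← Submodule.span_univ, Submodule.span_mul_span, Submodule.span_le]
  rintro _ ⟨_, ⟨a, -, b, hb, rfl⟩, r, -, rfl⟩
  exact h a b hb r

theorem mem_lieStep {B : Submodule ℤ R} (a : R) {b : R} (hb : b ∈ B) (r : R) :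
    (a * b - b * a) * r ∈ lieStep B :=
  Submodule.mul_mem_mul (Submodule.subset_span ⟨a, trivial, b, hb, rfl⟩) trivial

theorem lieStep_sup_le (B C : Submodule ℤ R) : lieStep (B ⊔ C) ≤ lieStep B ⊔ lieStep C := by
  refine lieStep_le fun a b hb r => ?_
  obtain ⟨x, hx, y, hy, rfl⟩ := Submodule.mem_sup.1 hb
  have h : (a * (x + y) - (x + y) * a) * r =
      (a * x - x * a) * r + (a * y - y * a) * r := by noncomm_ring
  rw [h]
  exact Submodule.add_mem_sup (mem_lieStep a hx r) (mem_lieStep a hy r)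

theorem lieStep_map_mulLeft_le {ζ : R} (hζ : ∀ a, Commute ζ a) (B : Submodule ℤ R) :
    lieStep (B.map (LinearMap.mulLeft ℤ ζ)) ≤ (lieStep B).map (LinearMap.mulLeft ℤ ζ) := by
  refine lieStep_le fun a b hb r => ?_
  obtain ⟨x, hx, rfl⟩ := hb
  refine ⟨_, mem_lieStep a hx r, ?_⟩
  simp only [LinearMap.mulLeft_apply]
  rw [← mul_assoc a, ← (hζ a).eq]
  noncomm_ring

theorem map_lieStep_le (f : R →ₐ[ℤ] S) (B : Submodule ℤ R) :
    (lieStep B).map f.toLinearMap ≤ lieStep (B.map f.toLinearMap) := by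
  rw [Submodule.map_le_iff_le_comap]
  refine lieStep_le fun a b hb r => ?_
  simp only [Submodule.mem_comap, AlgHom.toLinearMap_apply, map_mul, map_sub]
  exact mem_lieStep _ (Submodule.mem_map_of_mem hb) _

theorem lieStep_iterate_sup_le (n : ℕ) (B C : Submodule ℤ R) :
    lieStep^[n] (B ⊔ C) ≤ lieStep^[n] B ⊔ lieStep^[n] C := by
  induction n with
  | zero => rfl
  | succ n ih =>
    simp only [Function.iterate_succ_apply']
    exact (lieStep_mono ih).trans (lieStep_sup_le _ _)

theorem lieStep_iterate_map_mulLeft_le {ζ : R} (hζ : ∀ a, Commute ζ a) (n : ℕ)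
    (B : Submodule ℤ R) : lieStep^[n] (B.map (LinearMap.mulLeft ℤ ζ)) ≤
      (lieStep^[n] B).map (LinearMap.mulLeft ℤ ζ) := by
  induction n with
  | zero => rfl
  | succ n ih =>
    simp only [Function.iterate_succ_apply']
    exact (lieStep_mono ih).trans (lieStep_map_mulLeft_le hζ _)

theorem map_lieStep_iterate_le (f : R →ₐ[ℤ] S) (n : ℕ) :
    (lieStep^[n] ⊤).map f.toLinearMap ≤ lieStep^[n] ⊤ := by
  induction n with
  | zero => exact le_top
  | succ n ih =>
    simp only [Function.iterate_succ_apply']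
    exact (map_lieStep_le f _).trans (lieStep_mono ih)

theorem map_mulLeft_map_mulLeft (ζ ξ : R) (B : Submodule ℤ R) :
    (B.map (LinearMap.mulLeft ℤ ζ)).map (LinearMap.mulLeft ℤ ξ) =
      B.map (LinearMap.mulLeft ℤ (ξ * ζ)) := by
  rw [← Submodule.map_comp]
  congr 1
  ext x
  simp

/-- Central factors pull out of the operator, so each further block of `n` iterations gains one
factor `ζ` modulo `π`. It serves with `(ζ, π) = (z - 1, p)` in the induction on `|G|`, and with `(p,
0)` to reach all powers of `p`. -/
theorem lieStep_iterate_mul_le {ζ π : R} (hζ : ∀ a, Commute ζ a) (hπ : ∀ a, Commute π a) {n : ℕ}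
    (h : lieStep^[n] ⊤ ≤ (⊤ : Submodule ℤ R).map (LinearMap.mulLeft ℤ ζ) ⊔
      (⊤ : Submodule ℤ R).map (LinearMap.mulLeft ℤ π)) (k : ℕ) :
    lieStep^[n * k] ⊤ ≤ (⊤ : Submodule ℤ R).map (LinearMap.mulLeft ℤ (ζ ^ k)) ⊔
      (⊤ : Submodule ℤ R).map (LinearMap.mulLeft ℤ π) := by
  induction k with
  | zero => simp
  | succ k ih =>
    rw [Nat.mul_succ, Nat.add_comm, Function.iterate_add_apply]
    refine ((lieStep_mono.iterate n) ih).trans ((lieStep_iterate_sup_le _ _ _).trans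
      (sup_le ?_ ?_))
    · refine (lieStep_iterate_map_mulLeft_le (fun a => (hζ a).pow_left k) _ _).trans
        ((Submodule.map_mono h).trans ?_)
      rw [Submodule.map_sup, map_mulLeft_map_mulLeft, map_mulLeft_map_mulLeft, ← pow_succ,
        ((hζ π).pow_left k).eq, ← map_mulLeft_map_mulLeft _ π]
      exact sup_le_sup le_rfl (Submodule.map_mono le_top)
    · exact ((lieStep_iterate_map_mulLeft_le hπ _ _).trans
        (Submodule.map_mono le_top)).trans le_sup_right

end LieStep

/-- An upper bound is all that is needed, and replacing `Δ(G)` by the whole ring gives a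
construction compatible with any algebra homomorphism. -/
theorem lieAugmentationPower_le_lieStep_iterate (G : Type*) [Group G] (k : ℕ) :
    lieAugmentationPower G k ≤ lieStep^[k] ⊤ := by
  induction k with
  | zero => exact le_top
  | succ k ih =>
    rw [Function.iterate_succ_apply']
    exact mul_le_mul' (lieCommutator_mono le_top ih) le_rfl

/-! ### Vanishing of the Lie residue when `G` is nilpotent and `p`-abelian -/

theorem lieStep_top_eq_bot {G : Type*} [Group G] (h : ∀ a b : G, a * b = b * a) :
    lieStep (⊤ : Submodule ℤ (MonoidAlgebra ℤ G)) = ⊥ := by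
  rw [eq_bot_iff]
  refine lieStep_le fun a b _ r => ?_
  have hab : a * b = b * a := by
    let _ : CommGroup G := { mul_comm := h }
    exact mul_comm a b
  rw [hab, sub_self, zero_mul]
  exact zero_mem _

/-- If the image of `x` in `ℤ[G/⟨z⟩]` is divisible by `m`, then `x` lies in
`(z - 1) ℤG + m ℤG`. -/
theorem mem_of_mapDomain_mem {G : Type*} [Group G] [Finite G] {z : G}
    (hz : ∀ g, Commute z g) [(Subgroup.zpowers z).Normal] (m : ℤ) {x : MonoidAlgebra ℤ G}
    (hx : MonoidAlgebra.mapDomainAlgHom ℤ ℤ (QuotientGroup.mk' (Subgroup.zpowers z)) x ∈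
      (⊤ : Submodule ℤ (MonoidAlgebra ℤ (G ⧸ Subgroup.zpowers z))).map
        (LinearMap.mulLeft ℤ (m : MonoidAlgebra ℤ (G ⧸ Subgroup.zpowers z)))) :
    x ∈ (⊤ : Submodule ℤ (MonoidAlgebra ℤ G)).map
        (LinearMap.mulLeft ℤ (MonoidAlgebra.of ℤ G z - 1)) ⊔
      (⊤ : Submodule ℤ (MonoidAlgebra ℤ G)).map (LinearMap.mulLeft ℤ (m : MonoidAlgebra ℤ G)) := by
  obtain ⟨y, -, hy⟩ := hx
  -- An additive section only: it comes from a choice of coset representatives and is not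
  -- multiplicative.
  let σ : MonoidAlgebra ℤ (G ⧸ Subgroup.zpowers z) →+ MonoidAlgebra ℤ G :=
    { toFun := MonoidAlgebra.mapDomain Quotient.out
      map_zero' := by simp
      map_add' := by intro a b; simp [MonoidAlgebra.mapDomain_add] }
  have key : ∀ x : MonoidAlgebra ℤ G, x -
      σ (MonoidAlgebra.mapDomainAlgHom ℤ ℤ (QuotientGroup.mk' (Subgroup.zpowers z)) x) ∈
      (⊤ : Submodule ℤ (MonoidAlgebra ℤ G)).map
        (LinearMap.mulLeft ℤ (MonoidAlgebra.of ℤ G z - 1)) := by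
    intro x
    induction x using MonoidAlgebra.induction_linear with
    | zero => simp
    | add x y hx hy =>
      rw [map_add, map_add, add_sub_add_comm]
      exact add_mem hx hy
    | single g n =>
      obtain ⟨k, hk⟩ : ∃ k : ℕ, (Quotient.out (g : G ⧸ Subgroup.zpowers z)) = z ^ k * g := by
        have h1 : (g : G ⧸ Subgroup.zpowers z) = (Quotient.out (g : G ⧸ Subgroup.zpowers z) : G) :=
          (Quotient.out_eq' _).symm
        rw [QuotientGroup.eq] at h1
        obtain ⟨k, hk⟩ := (isOfFinOrder_of_finite z).mem_powers_iff_mem_zpowers.2 h1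
        exact ⟨k, by rw [((hz g).pow_left k).eq]; exact (eq_mul_of_inv_mul_eq hk.symm)⟩
      have h2 : σ (MonoidAlgebra.mapDomainAlgHom ℤ ℤ (QuotientGroup.mk' (Subgroup.zpowers z))
          (MonoidAlgebra.single g n)) = MonoidAlgebra.of ℤ G z ^ k * MonoidAlgebra.single g n := by
        simp [σ, hk]
      rw [h2]
      refine ⟨-(∑ i ∈ Finset.range k, MonoidAlgebra.of ℤ G z ^ i) * MonoidAlgebra.single g n,
        trivial, ?_⟩
      rw [LinearMap.mulLeft_apply, ← mul_assoc, mul_neg, mul_geom_sum, neg_sub, sub_mul, one_mul]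
  have h := key x
  rw [← hy, LinearMap.mulLeft_apply, ← zsmul_eq_mul, map_zsmul, zsmul_eq_mul] at h
  rw [← sub_add_cancel x (m * σ y)]
  exact Submodule.add_mem_sup h ⟨σ y, trivial, rfl⟩

/-- The last nontrivial term of the lower central series is central and, as `G` is not abelian, lies
in `G'`; a power of any nontrivial element of it has order `p`. -/
theorem exists_orderOf_eq_central_mem_commutator {G : Type*} [Group G] [Finite G]
    [Group.IsNilpotent G] {p : ℕ} (hp : p.Prime) (hG : IsPGroup p (commutator G))
    (h : commutator G ≠ ⊥) :
    ∃ z ∈ commutator G, orderOf z = p ∧ ∀ g, Commute z g := by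
  have hex := Subgroup.nilpotent_iff_lowerCentralSeries.1 (inferInstance : Group.IsNilpotent G)
  classical
  obtain ⟨n, hn⟩ : ∃ n, Nat.find hex = n + 2 := by
    refine Nat.exists_eq_add_of_le' ?_
    by_contra! hlt
    refine h (eq_bot_iff.2 ?_)
    rw [← Subgroup.top_lowerCentralSeries_one, ← Nat.find_spec hex]
    exact Subgroup.lowerCentralSeries_antitone _ (by omega)
  have h1 : (⊤ : Subgroup G).lowerCentralSeries (n + 1) ≠ ⊥ := Nat.find_min hex (by omega)
  have h2 : (⊤ : Subgroup G).lowerCentralSeries (n + 1 + 1) = ⊥ := by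
    rw [← Nat.find_spec hex, hn]
  have h3 : (⊤ : Subgroup G).lowerCentralSeries (n + 1) ≤ commutator G := by
    rw [← Subgroup.top_lowerCentralSeries_one]
    exact Subgroup.lowerCentralSeries_antitone _ (by omega)
  have := Fact.mk hp
  obtain ⟨⟨g, hg⟩, hg1⟩ := Subgroup.ne_bot_iff_exists_ne_one.1 h1
  replace hg1 : g ≠ 1 := fun h => hg1 (Subtype.ext h)
  have hcent : ∀ a, Commute g a := fun a => by
    have h4 : ⁅g, a⁆ ∈ (⊤ : Subgroup G).lowerCentralSeries (n + 1 + 1) :=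
      Subgroup.commutator_mem_commutator hg (Subgroup.mem_top a)
    rw [h2, Subgroup.mem_bot, commutatorElement_eq_one_iff_commute] at h4
    exact h4
  obtain ⟨m, hm⟩ : p ∣ orderOf g := by
    have h5 := hG.dvd_orderOf (g := ⟨g, h3 hg⟩) fun h => hg1 (congrArg Subtype.val h)
    rwa [Subgroup.orderOf_mk] at h5
  have hm0 : m ≠ 0 := by
    rintro rfl
    exact (orderOf_pos g).ne' (by simpa using hm)
  exact ⟨g ^ m, pow_mem (h3 hg) m, by
    rw [orderOf_pow_of_dvd hm0 (hm ▸ Dvd.intro_left p rfl), hm,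
      Nat.mul_div_cancel _ (Nat.pos_of_ne_zero hm0)], fun a => (hcent a).pow_left m⟩

theorem exists_lieStep_iterate_le {p : ℕ} (hp : p.Prime) (G : Type*) [Group G] [Finite G]
    [Group.IsNilpotent G] (hG : IsPGroup p (commutator G)) :
    ∃ n, lieStep^[n] ⊤ ≤ (⊤ : Submodule ℤ (MonoidAlgebra ℤ G)).map
      (LinearMap.mulLeft ℤ (((p : ℤ) : MonoidAlgebra ℤ G))) := by
  induction hn : Nat.card G using Nat.strong_induction_on generalizing G with
  | _ n ih =>
  by_cases h : commutator G = ⊥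
  · refine ⟨1, ?_⟩
    rw [Function.iterate_one, lieStep_top_eq_bot]
    · exact bot_le
    · intro a b
      have h4 : ⁅a, b⁆ ∈ commutator G :=
        Subgroup.commutator_mem_commutator (Subgroup.mem_top a) (Subgroup.mem_top b)
      rwa [h, Subgroup.mem_bot, commutatorElement_eq_one_iff_mul_comm] at h4
  obtain ⟨z, hz, hzp, hzc⟩ := exists_orderOf_eq_central_mem_commutator hp hG h
  have hnorm : (Subgroup.zpowers z).Normal := by
    refine ⟨fun x hx g => ?_⟩
    obtain ⟨k, rfl⟩ := hx
    have h1 := ((hzc g).zpow_left k).eq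
    rw [← h1, mul_inv_cancel_right]
    exact ⟨k, rfl⟩
  have hcard : Nat.card (G ⧸ Subgroup.zpowers z) < n := by
    have h1 := Subgroup.card_eq_card_quotient_mul_card_subgroup (Subgroup.zpowers z)
    rw [Nat.card_zpowers, hzp, hn] at h1
    rw [h1]
    exact lt_mul_of_one_lt_right Nat.card_pos hp.one_lt
  have hcomm : IsPGroup p (commutator (G ⧸ Subgroup.zpowers z)) := by
    have h1 : commutator (G ⧸ Subgroup.zpowers z) =
        (commutator G).map (QuotientGroup.mk' (Subgroup.zpowers z)) := by
      rw [commutator_def, commutator_def, Subgroup.map_commutator,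
        Subgroup.map_top_of_surjective _ (QuotientGroup.mk'_surjective _)]
    rw [h1]
    exact hG.map _
  obtain ⟨N, hN⟩ := ih _ hcard (G ⧸ Subgroup.zpowers z) hcomm rfl
  have h1 : lieStep^[N] ⊤ ≤ (⊤ : Submodule ℤ (MonoidAlgebra ℤ G)).map
        (LinearMap.mulLeft ℤ (MonoidAlgebra.of ℤ G z - 1)) ⊔
      (⊤ : Submodule ℤ (MonoidAlgebra ℤ G)).map
        (LinearMap.mulLeft ℤ ((p : ℤ) : MonoidAlgebra ℤ G)) := fun x hx =>
    mem_of_mapDomain_mem hzc p (hN (map_lieStep_iterate_le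
      (MonoidAlgebra.mapDomainAlgHom ℤ ℤ (QuotientGroup.mk' (Subgroup.zpowers z))) N ⟨x, hx, rfl⟩))
  have hzc' : ∀ a, Commute (MonoidAlgebra.of ℤ G z) a := MonoidAlgebra.of_commute hzc
  refine ⟨N * p, (lieStep_iterate_mul_le (fun a => (hzc' a).sub_left (Commute.one_left a))
    (fun a => Int.cast_commute _ a) h1 p).trans (sup_le ?_ le_rfl)⟩
  -- Expand `1 = z^p = ((z - 1) + 1)^p`: the middle binomial terms are divisible by `p`.
  obtain ⟨r, hr⟩ : ((p : ℤ) : MonoidAlgebra ℤ G) ∣ (MonoidAlgebra.of ℤ G z - 1) ^ p := by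
    obtain ⟨r, hr⟩ := (Commute.one_right (MonoidAlgebra.of ℤ G z - 1)).exists_add_pow_prime_eq hp
    rw [sub_add_cancel, ← map_pow, ← hzp, pow_orderOf_eq_one, map_one, one_pow, hzp, mul_one,
      add_right_comm, right_eq_add] at hr
    exact ⟨-((MonoidAlgebra.of ℤ G z - 1) * r), by
      rw [mul_neg, ← mul_assoc, Int.cast_natCast]; exact eq_neg_of_add_eq_zero_left hr⟩
  rw [hr, ← map_mulLeft_map_mulLeft]
  exact Submodule.map_mono le_top

theorem lieAugmentationResidue_eq_bot {p : ℕ} (hp : p.Prime) (G : Type*) [Group G] [Finite G]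
    [Group.IsNilpotent G] (hG : IsPGroup p (commutator G)) : lieAugmentationResidue G = ⊥ := by
  obtain ⟨n, hn⟩ := exists_lieStep_iterate_le hp G hG
  rw [eq_bot_iff]
  intro x hx
  rw [lieAugmentationResidue, Submodule.mem_iInf] at hx
  have h1 : ∀ k : ℕ, ∃ y : MonoidAlgebra ℤ G, ((p : ℤ) : MonoidAlgebra ℤ G) ^ k * y = x := by
    intro k
    have h2 := lieStep_iterate_mul_le (fun a => Int.cast_commute (p : ℤ) a)
      (fun a => Commute.zero_left a) (hn.trans le_sup_left) k
      (lieAugmentationPower_le_lieStep_iterate G (n * k) (hx _))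
    have h3 : (⊤ : Submodule ℤ (MonoidAlgebra ℤ G)).map
        (LinearMap.mulLeft ℤ (0 : MonoidAlgebra ℤ G)) = ⊥ := by
      rw [LinearMap.mulLeft_zero_eq_zero, Submodule.map_zero]
    rw [h3, sup_bot_eq] at h2
    obtain ⟨y, -, hy⟩ := h2
    exact ⟨y, hy⟩
  rw [Submodule.mem_bot]
  ext g
  by_contra hg
  -- A nonzero integer coefficient is not divisible by every power of `p`.
  obtain ⟨k, hk⟩ := Int.finiteMultiplicity_iff.2 ⟨(by simpa using hp.one_lt.ne' :
    (p : ℤ).natAbs ≠ 1), hg⟩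
  refine hk ?_
  obtain ⟨y, rfl⟩ := h1 (k + 1)
  rw [← Int.cast_pow, ← zsmul_eq_mul, MonoidAlgebra.coeff_smul_apply, smul_eq_mul]
  exact ⟨y.coeff g, rfl⟩

/-! ### From Lie powers to the lower central series of the units -/

theorem mul_mem_lieAugmentationPower {G : Type*} [Group G] (k : ℕ) {x : MonoidAlgebra ℤ G}
    (hx : x ∈ lieAugmentationPower G k) (y : MonoidAlgebra ℤ G) :
    x * y ∈ lieAugmentationPower G k := by
  cases k with
  | zero =>
    simp only [lieAugmentationPower, augmentationIdeal, LinearMap.mem_ker,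
      AlgHom.toLinearMap_apply, map_mul] at hx ⊢
    rw [hx, zero_mul]
  | succ k =>
    have h := Submodule.mul_mem_mul hx (Submodule.mem_top (x := y) (R := ℤ))
    have h2 : lieAugmentationPower G (k + 1) * ⊤ ≤ lieAugmentationPower G (k + 1) := by
      simp only [lieAugmentationPower]
      rw [mul_assoc]
      exact mul_le_mul' le_rfl le_top
    exact h2 h

theorem augmentation_normalizedUnits {G : Type*} [Group G] (u : normalizedUnits G) :
    augmentation G ((u : (MonoidAlgebra ℤ G)ˣ) : MonoidAlgebra ℤ G) = 1 := by
  simpa using congrArg Units.val (MonoidHom.mem_ker.1 u.2)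

/-- The commutator case is `⁅u, v⁆ - 1 = -[v - 1, u - 1] u⁻¹v⁻¹`; products and inverses work because
the Lie powers are right ideals. Both series are indexed from zero, so the indices match. -/
theorem sub_one_mem_of_mem_lowerCentralSeries {G : Type*} [Group G] (n : ℕ)
    (u : normalizedUnits G) (hu : u ∈ (⊤ : Subgroup (normalizedUnits G)).lowerCentralSeries n) :
    ((u : (MonoidAlgebra ℤ G)ˣ) : MonoidAlgebra ℤ G) - 1 ∈ lieAugmentationPower G n := by
  induction n generalizing u with
  | zero =>
    simp [lieAugmentationPower, augmentationIdeal, augmentation_normalizedUnits]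
  | succ n ih =>
    rw [Subgroup.mem_lowerCentralSeries_succ_iff] at hu
    induction hu using Subgroup.closure_induction with
    | one => simp
    | mul x y _ _ hx hy =>
      have h : (((x * y : normalizedUnits G) : (MonoidAlgebra ℤ G)ˣ) : MonoidAlgebra ℤ G) - 1 =
          (((x : (MonoidAlgebra ℤ G)ˣ) : MonoidAlgebra ℤ G) - 1) *
            ((y : (MonoidAlgebra ℤ G)ˣ) : MonoidAlgebra ℤ G) +
          (((y : (MonoidAlgebra ℤ G)ˣ) : MonoidAlgebra ℤ G) - 1) := by
        push_cast
        noncomm_ring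
      rw [h]
      exact add_mem (mul_mem_lieAugmentationPower _ hx _) hy
    | inv x _ hx =>
      have h : (((x⁻¹ : normalizedUnits G) : (MonoidAlgebra ℤ G)ˣ) : MonoidAlgebra ℤ G) - 1 =
          -((((x : (MonoidAlgebra ℤ G)ˣ) : MonoidAlgebra ℤ G) - 1) *
            (((x⁻¹ : normalizedUnits G) : (MonoidAlgebra ℤ G)ˣ) : MonoidAlgebra ℤ G)) := by
        simp [sub_mul]
      rw [h]
      exact neg_mem (mul_mem_lieAugmentationPower _ hx _)
    | mem x hx =>
      obtain ⟨u, hu, v, -, rfl⟩ := hx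
      have h : (((⁅u, v⁆ : normalizedUnits G) : (MonoidAlgebra ℤ G)ˣ) : MonoidAlgebra ℤ G) - 1 =
          -(((((v : (MonoidAlgebra ℤ G)ˣ) : MonoidAlgebra ℤ G) - 1) *
            (((u : (MonoidAlgebra ℤ G)ˣ) : MonoidAlgebra ℤ G) - 1) -
            (((u : (MonoidAlgebra ℤ G)ˣ) : MonoidAlgebra ℤ G) - 1) *
            (((v : (MonoidAlgebra ℤ G)ˣ) : MonoidAlgebra ℤ G) - 1)) *
            (((u⁻¹ * v⁻¹ : normalizedUnits G) : (MonoidAlgebra ℤ G)ˣ) : MonoidAlgebra ℤ G)) := by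
        have h1 : (((v * u * (u⁻¹ * v⁻¹) : normalizedUnits G) : (MonoidAlgebra ℤ G)ˣ) :
            MonoidAlgebra ℤ G) = 1 := by simp
        rw [commutatorElement_def]
        push_cast at h1 ⊢
        have h2 : ∀ a b c : MonoidAlgebra ℤ G, b * a * c = 1 →
            a * b * c - 1 = -(((b - 1) * (a - 1) - (a - 1) * (b - 1)) * c) := by
          intro a b c habc
          rw [show a * b * c - 1 = a * b * c - b * a * c by rw [habc]]
          noncomm_ring
        rw [mul_assoc (_ * _)]
        exact h2 _ _ _ h1
      rw [h]
      refine neg_mem (Submodule.mul_mem_mul (Submodule.subset_span ⟨_, ?_, _, ih u hu, rfl⟩)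
        Submodule.mem_top)
      simp [augmentationIdeal, augmentation_normalizedUnits]

theorem isResiduallyNilpotent_normalizedUnits {G : Type*} [Group G]
    (h : lieAugmentationResidue G = ⊥) : IsResiduallyNilpotent (normalizedUnits G) := by
  rw [IsResiduallyNilpotent, nilpotentResidue, eq_bot_iff]
  intro u hu
  rw [Subgroup.mem_iInf] at hu
  have h1 : ((u : (MonoidAlgebra ℤ G)ˣ) : MonoidAlgebra ℤ G) - 1 ∈ lieAugmentationResidue G :=
    (Submodule.mem_iInf _).2 fun n => sub_one_mem_of_mem_lowerCentralSeries n u (hu n)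
  rw [h, Submodule.mem_bot, sub_eq_zero] at h1
  exact Subtype.ext (Units.ext h1)

/-! ### Central commutators of order `p` in finite `p`-groups -/

theorem pow_mul_eq_mul_mul_pow {M : Type*} [Monoid M] {x y c : M} (h : x * y = y * x * c)
    (n : ℕ) : x ^ n * y = y * (x * c) ^ n := by
  induction n with
  | zero => simp
  | succ n ih =>
    rw [pow_succ', mul_assoc, ih, ← mul_assoc, h, pow_succ', mul_assoc y x c, mul_assoc]

theorem mul_pow_of_mul_eq_mul_mul {M : Type*} [Monoid M] {x y c : M} (h : x * y = y * x * c)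
    (hcx : Commute c x) (hcy : Commute c y) (n : ℕ) :
    (y * x) ^ n = y ^ n * x ^ n * c ^ (n * (n - 1) / 2) := by
  induction n with
  | zero => simp
  | succ n ih =>
    have hc : ∀ k, Commute (c ^ k) y := fun k => hcy.pow_left k
    have h1 : x ^ n * y = y * x ^ n * c ^ n := by
      rw [pow_mul_eq_mul_mul_pow h, hcx.symm.mul_pow, mul_assoc]
    have h2 : (n + 1) * (n + 1 - 1) / 2 = n + n * (n - 1) / 2 := by
      rw [Nat.triangle_succ]; omega
    rw [pow_succ, ih, h2]
    calc y ^ n * x ^ n * c ^ (n * (n - 1) / 2) * (y * x)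
        = y ^ n * x ^ n * (c ^ (n * (n - 1) / 2) * (y * x)) := by simp only [mul_assoc]
      _ = y ^ n * x ^ n * (y * x * c ^ (n * (n - 1) / 2)) := by
          rw [((hcy.mul_right hcx).pow_left _).eq]
      _ = y ^ n * (x ^ n * y) * (x * c ^ (n * (n - 1) / 2)) := by simp only [mul_assoc]
      _ = y ^ n * y * x ^ n * (c ^ n * x) * c ^ (n * (n - 1) / 2) := by
          rw [h1]; simp only [mul_assoc]
      _ = y ^ n * y * x ^ n * (x * c ^ n) * c ^ (n * (n - 1) / 2) := by
          rw [(hcx.pow_left n).eq]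
      _ = y ^ (n + 1) * x ^ (n + 1) * (c ^ n * c ^ (n * (n - 1) / 2)) := by
          simp only [mul_assoc, pow_succ]
      _ = y ^ (n + 1) * x ^ (n + 1) * c ^ (n + n * (n - 1) / 2) := by rw [← pow_add c]

/-- In the collection formula the exponent of `c` is `p^k (p^k - 1) / 2`: zero for `k = 0`, and
otherwise divisible by `p` because `p` is odd. -/
theorem mul_pow_prime_pow_of_mul_eq_mul_mul {M : Type*} [Monoid M] {x y c : M} {p : ℕ}
    (hp : p.Prime) (hodd : p ≠ 2) (h : x * y = y * x * c)
    (hcx : Commute c x) (hcy : Commute c y) (hc : c ^ p = 1) (k : ℕ) :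
    (y * x) ^ p ^ k = y ^ p ^ k * x ^ p ^ k := by
  rw [mul_pow_of_mul_eq_mul_mul h hcx hcy]
  obtain rfl | hk := Nat.eq_zero_or_pos k
  · simp
  have h2 : p ∣ p ^ k * (p ^ k - 1) / 2 := by
    have h3 : 2 ∣ p ^ k - 1 :=
      (Nat.Odd.sub_odd (hp.odd_of_ne_two hodd).pow odd_one).two_dvd
    rw [Nat.mul_div_assoc _ h3]
    exact Dvd.dvd.mul_right (dvd_pow_self p hk.ne') _
  obtain ⟨m, hm⟩ := h2
  rw [hm, pow_mul, hc, one_pow, mul_one]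

/-- `x` and `y` have a commutator `c` of order `p` that commutes with both. -/
structure IsCommutatorTriple {G : Type*} [Group G] (p : ℕ) (x y c : G) : Prop where
  eq : x * y = y * x * c
  left : Commute c x
  right : Commute c y
  order : orderOf c = p

theorem IsCommutatorTriple.symm {G : Type*} [Group G] {p : ℕ} {x y c : G}
    (h : IsCommutatorTriple p x y c) : IsCommutatorTriple p y x c⁻¹ where
  eq := by rw [h.eq, mul_inv_cancel_right]
  left := h.right.inv_left
  right := h.left.inv_left
  order := by rw [orderOf_inv, h.order]

theorem exists_isCommutatorTriple {G : Type*} [Group G] [Finite G] {p : ℕ} (hp : p.Prime)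
    (hG : IsPGroup p G) (hne : ¬ ∀ a b : G, a * b = b * a) :
    ∃ x y c : G, IsCommutatorTriple p x y c := by
  have := Fact.mk hp
  have hnt : Nontrivial (G ⧸ Subgroup.center G) := by
    rw [QuotientGroup.nontrivial_iff]
    intro h
    exact hne fun a b => Subgroup.mem_center_iff.1 (h ▸ Subgroup.mem_top b) a
  have hcn := (hG.to_quotient (Subgroup.center G)).center_nontrivial
  obtain ⟨⟨q, hq⟩, hq1⟩ := exists_ne (1 : Subgroup.center (G ⧸ Subgroup.center G))
  obtain ⟨x, rfl⟩ := QuotientGroup.mk_surjective q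
  have hx : x ∉ Subgroup.center G := fun h =>
    hq1 (Subtype.ext ((QuotientGroup.eq_one_iff x).2 h))
  have hxc : ∀ y, (y * x)⁻¹ * (x * y) ∈ Subgroup.center G := fun y =>
    QuotientGroup.eq.1 (Subgroup.mem_center_iff.1 hq y)
  obtain ⟨y, hy⟩ : ∃ y, y * x ≠ x * y := by
    by_contra! h
    exact hx (Subgroup.mem_center_iff.2 h)
  set e := (y * x)⁻¹ * (x * y) with he
  have hec : ∀ g, Commute e g := fun g => (Subgroup.mem_center_iff.1 (hxc y) g).symm
  have he1 : e ≠ 1 := fun h => hy (inv_mul_eq_one.1 h)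
  have hxy' : x * y = y * x * e := by
    rw [he]; group
  obtain ⟨m, hm⟩ : p ∣ orderOf e := hG.dvd_orderOf he1
  have hm0 : m ≠ 0 := by
    rintro rfl
    exact (orderOf_pos e).ne' (by simpa using hm)
  -- `x` is central modulo the center, so its commutator `e` with `y` is central, of order `p * m`;
  -- passing to `x ^ m` replaces `e` by `e ^ m`, of order `p`.
  refine ⟨x ^ m, y, e ^ m, ?_, (hec _).pow_left _, (hec _).pow_left _, ?_⟩
  · rw [pow_mul_eq_mul_mul_pow hxy', (hec x).symm.mul_pow, mul_assoc]
  · rw [orderOf_pow_of_dvd hm0 (hm ▸ Dvd.intro_left p rfl), hm,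
      Nat.mul_div_cancel _ (Nat.pos_of_ne_zero hm0)]

theorem exists_eq_pow_mul_of_mem_zpowers {G : Type*} [Group G] {p m : ℕ} (hp : p.Prime)
    {x c : G} (hx : orderOf x = p ^ (m + 1)) (hc : orderOf c = p)
    (h : c ∈ Subgroup.zpowers x) : ∃ i : ℕ, c = (x ^ p ^ m) ^ i := by
  have hfin : IsOfFinOrder x := orderOf_pos_iff.1 (hx ▸ pow_pos hp.pos _)
  obtain ⟨i, rfl⟩ := hfin.mem_powers_iff_mem_zpowers.2 h
  have h1 : x ^ (i * p) = 1 := by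
    rw [pow_mul, ← hc]
    exact pow_orderOf_eq_one _
  have h2 := orderOf_dvd_of_pow_eq_one h1
  rw [hx, pow_succ] at h2
  obtain ⟨j, rfl⟩ := Nat.dvd_of_mul_dvd_mul_right hp.pos h2
  exact ⟨j, by rw [← pow_mul]⟩

/-- If `c` lies in both `⟨x⟩` and `⟨y⟩`, then `y` can be replaced by an element of smaller
order. -/
theorem IsCommutatorTriple.exists_orderOf_lt {G : Type*} [Group G] {p k l : ℕ} (hp : p.Prime)
    (hodd : p ≠ 2) {x y c : G} (h : IsCommutatorTriple p x y c)
    (hx : orderOf x = p ^ (k + l + 1)) (hy : orderOf y = p ^ (l + 1))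
    (hcx : c ∈ Subgroup.zpowers x) (hcy : c ∈ Subgroup.zpowers y) :
    ∃ y' c', IsCommutatorTriple p x y' c' ∧ orderOf y' < orderOf y := by
  obtain ⟨i, hi⟩ := exists_eq_pow_mul_of_mem_zpowers hp hx h.order hcx
  obtain ⟨j, hj⟩ := exists_eq_pow_mul_of_mem_zpowers hp hy h.order hcy
  have hc1 : c ≠ 1 := fun h1 => hp.one_lt.ne (by rw [← h.order, h1, orderOf_one])
  have hcp : c ^ p = 1 := h.order ▸ pow_orderOf_eq_one c
  have hpj : ¬ p ∣ j := by
    rintro ⟨j, rfl⟩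
    refine hc1 ?_
    rw [hj, ← pow_mul, ← mul_assoc, ← pow_succ, pow_mul, ← hy, pow_orderOf_eq_one, one_pow]
  -- Since `x ^ (p ^ (k + l) * i) = c = y ^ (p ^ l * j)`, the element `u * y ^ j` has trivial `p ^
  -- l`-th power. Its commutator with `x` is `c ^ j`, still of order `p` as `p ∤ j`.
  set u := (x ^ (p ^ k * i))⁻¹ with hu
  have hxu : Commute x u := ((Commute.refl x).pow_right _).inv_right
  have hcu : Commute c u := (h.left.pow_right _).inv_right
  have hyj : x * y ^ j = y ^ j * x * c ^ j := by
    have h1 := pow_mul_eq_mul_mul_pow h.symm.eq j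
    rw [h.symm.left.symm.mul_pow, inv_pow, ← mul_assoc, eq_mul_inv_iff_mul_eq] at h1
    rw [← h1]
  refine ⟨u * y ^ j, c ^ j, ⟨?_, h.left.pow_left _, 
    (hcu.mul_right (h.right.pow_right _)).pow_left _, ?_⟩, ?_⟩
  · rw [← mul_assoc, hxu.eq, mul_assoc, hyj]
    simp only [mul_assoc]
  · rw [Nat.Coprime.orderOf_pow _, h.order]
    rw [h.order]
    exact (hp.coprime_iff_not_dvd).2 hpj
  · have hle : orderOf (u * y ^ j) ∣ p ^ l := by
      apply orderOf_dvd_of_pow_eq_one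
      have hyu : ∃ e, y ^ j * u = u * y ^ j * e ∧ Commute e (y ^ j) ∧ Commute e u ∧ e ^ p = 1 := by
        have h1 : x ^ (p ^ k * i) * y ^ j = y ^ j * x ^ (p ^ k * i) * (c ^ j) ^ (p ^ k * i) := by
          rw [pow_mul_eq_mul_mul_pow hyj, (h.left.pow_left j).symm.mul_pow, mul_assoc]
        refine ⟨(c ^ j) ^ (p ^ k * i), ?_, ((h.right.pow_left _).pow_left _).pow_right _,
          (hcu.pow_left _).pow_left _, ?_⟩
        · have h2 := ((hcu.pow_left j).pow_left (p ^ k * i)).eq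
          calc y ^ j * u = u * (x ^ (p ^ k * i) * y ^ j) * u := by simp [hu]
            _ = u * (y ^ j * x ^ (p ^ k * i) * (c ^ j) ^ (p ^ k * i)) * u := by rw [h1]
            _ = u * y ^ j * x ^ (p ^ k * i) * ((c ^ j) ^ (p ^ k * i) * u) := by
              simp only [mul_assoc]
            _ = u * y ^ j * (c ^ j) ^ (p ^ k * i) := by rw [h2]; simp [hu, mul_assoc]
        · rw [pow_right_comm, pow_right_comm c, hcp, one_pow, one_pow]
      obtain ⟨e, h1, h2, h3, h4⟩ := hyu
      rw [mul_pow_prime_pow_of_mul_eq_mul_mul hp hodd h1 h2 h3 h4, ← pow_mul, mul_comm j, pow_mul,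
        ← hj, hu, inv_pow, ← pow_mul, mul_right_comm, ← pow_add, pow_mul, ← hi, inv_mul_cancel]
    rw [hy]
    exact (Nat.le_of_dvd (pow_pos hp.pos _) hle).trans_lt (Nat.pow_lt_pow_succ hp.one_lt)

/-- Descent on `orderOf x + orderOf y`: while `c` lies in both cyclic groups, the generator of
smaller order can be replaced by one of still smaller order. -/
theorem exists_isCommutatorTriple_notMem_zpowers {G : Type*} [Group G] [Finite G] {p : ℕ}
    (hp : p.Prime) (hodd : p ≠ 2) (hG : IsPGroup p G) (hne : ¬ ∀ a b : G, a * b = b * a) :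
    ∃ x y c : G, IsCommutatorTriple p x y c ∧ c ∉ Subgroup.zpowers x := by
  have := Fact.mk hp
  obtain ⟨x, y, c, h⟩ := exists_isCommutatorTriple hp hG hne
  induction hn : orderOf x + orderOf y using Nat.strong_induction_on generalizing x y c with
  | _ n ih =>
  by_cases hcx : c ∈ Subgroup.zpowers x
  swap
  · exact ⟨x, y, c, h, hcx⟩
  by_cases hcy : c ∈ Subgroup.zpowers y
  swap
  · exact ⟨y, x, c⁻¹, h.symm, by rwa [inv_mem_iff]⟩
  have key : ∀ {x : G}, c ∈ Subgroup.zpowers x → ∃ k, orderOf x = p ^ (k + 1) := by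
    intro x hx
    obtain ⟨k, hk⟩ := IsPGroup.iff_orderOf.1 hG x
    cases k with
    | zero =>
      rw [pow_zero, orderOf_eq_one_iff] at hk
      subst hk
      have hc1 : c = 1 := by simpa using hx
      exact absurd (by rw [← h.order, hc1, orderOf_one]) hp.one_lt.ne
    | succ k => exact ⟨k, hk⟩
  obtain ⟨k, hk⟩ := key hcx
  obtain ⟨l, hl⟩ := key hcy
  rcases le_total l k with hlk | hlk
  · obtain ⟨m, rfl⟩ := Nat.exists_eq_add_of_le' hlk
    obtain ⟨y', c', h', hlt⟩ := h.exists_orderOf_lt hp hodd hk hl hcx hcy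
    exact ih _ (by omega) x y' c' h' rfl
  · obtain ⟨m, rfl⟩ := Nat.exists_eq_add_of_le' hlk
    obtain ⟨y', c', h', hlt⟩ := h.symm.exists_orderOf_lt hp hodd hl hk (inv_mem hcy) (inv_mem hcx)
    exact ih _ (by omega) y y' c' h' rfl

/-! ### Sylow subgroups of a nilpotent group -/

/-- If the commutator subgroup has order divisible by `p`, the Sylow `p`-subgroups of a nilpotent
group are not abelian. -/
theorem Sylow.not_comm_of_dvd_card_commutator {G : Type*} [Group G] [Finite G]
    [Group.IsNilpotent G] {p : ℕ} [Fact p.Prime] (hp : p ∣ Nat.card (commutator G))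
    (P : Sylow p G) : ¬ ∀ a b : P, a * b = b * a := by
  intro hcomm
  obtain ⟨e⟩ := (Group.isNilpotent_of_finite_tfae (G := G)).out 0 4 rfl rfl |>.1 inferInstance
  obtain ⟨g, hg⟩ := exists_prime_orderOf_dvd_card' p hp
  have hpG : p ∈ (Nat.card G).primeFactors :=
    Nat.mem_primeFactors.2 ⟨Fact.out, hp.trans (Subgroup.card_subgroup_dvd_card _),
      Nat.card_pos.ne'⟩
  have hsub : Subsingleton (Sylow p G) := by
    have := Sylow.unique_of_normal P inferInstance
    infer_instance
  let f : G →* P :=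
    ((Pi.evalMonoidHom (fun P : Sylow p G => (P : Subgroup G)) P).comp
      (Pi.evalMonoidHom (fun p : (Nat.card G).primeFactors =>
        ∀ P : Sylow p G, (P : Subgroup G)) ⟨p, hpG⟩)).comp e.symm.toMonoidHom
  have hf : commutator G ≤ f.ker := by
    rw [commutator_def, Subgroup.commutator_le]
    intro a _ b _
    rw [MonoidHom.mem_ker, map_commutatorElement, commutatorElement_eq_one_iff_mul_comm]
    exact hcomm _ _
  -- The `p`-component dies because the projection to an abelian `P` kills `G'`; the other
  -- components die because `g` has order `p`.
  have hg1 : e.symm g = 1 := by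
    funext q Q
    obtain ⟨q, hq⟩ := q
    have hqp : q.Prime := (Nat.mem_primeFactors.1 hq).1
    have := Fact.mk hqp
    by_cases hqe : q = p
    · subst hqe
      obtain rfl := Subsingleton.elim P Q
      exact MonoidHom.mem_ker.1 (hf g.2)
    · obtain ⟨k, hk⟩ := IsPGroup.iff_orderOf.1 Q.isPGroup' (e.symm g ⟨q, hq⟩ Q)
      have h1 : (e.symm g ⟨q, hq⟩ Q) ^ p = 1 := by
        have : e.symm (g : G) ^ p = 1 := by
          rw [← map_pow, ← Subgroup.coe_pow, ← hg, pow_orderOf_eq_one]; simp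
        exact congrFun (congrFun this ⟨q, hq⟩) Q
      have h2 := orderOf_dvd_of_pow_eq_one h1
      rw [hk, Nat.dvd_prime Fact.out] at h2
      rcases h2 with h2 | h2
      · rw [h2] at hk
        exact orderOf_eq_one_iff.1 hk
      · exact absurd ((Nat.prime_dvd_prime_iff_eq hqp Fact.out).1
          (h2 ▸ dvd_pow_self q (by rintro rfl; simp at h2; exact (Fact.out : p.Prime).one_lt.ne h2))) hqe
  rw [map_eq_one_iff _ e.symm.injective] at hg1
  have : g = 1 := Subtype.ext hg1
  rw [this, orderOf_one] at hg
  exact (Fact.out : p.Prime).one_lt.ne hg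

/-! ### Square-zero elements and units in every term of the lower central series -/

/-- Modulo the ideal of the three elements, `c^p = d^q = 1` and `cd = 1`, so `c^q = 1` and
coprimality forces `c = d = 1`. The geometric sums then become `p` and `q`, so both vanish, and
Bézout gives `1 = 0`. -/
theorem exists_mul_geom_sum_add_eq_one {R : Type*} [CommRing R] {p q : ℕ} (hpq : p.Coprime q)
    (c d : R) : ∃ u v r : R, u * ∑ i ∈ Finset.range p, c ^ i + v * ∑ i ∈ Finset.range q, d ^ i +
      r * (1 - c * d) = 1 := by
  set x := ∑ i ∈ Finset.range p, c ^ i with hx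
  set y := ∑ i ∈ Finset.range q, d ^ i with hy
  set I : Ideal R := Ideal.span {x, y, 1 - c * d} with hI
  have hmem : ∀ t ∈ ({x, y, 1 - c * d} : Set R), Ideal.Quotient.mk I t = 0 := fun t ht =>
    Ideal.Quotient.eq_zero_iff_mem.2 (Ideal.subset_span ht)
  set f := Ideal.Quotient.mk I with hf
  have h1 : ∑ i ∈ Finset.range p, f c ^ i = 0 := by simpa [hx] using hmem x (by simp)
  have h2 : ∑ i ∈ Finset.range q, f d ^ i = 0 := by simpa [hy] using hmem y (by simp)
  have h3 : f c * f d = 1 := by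
    have h := hmem (1 - c * d) (by simp)
    rw [map_sub, map_one, map_mul, sub_eq_zero] at h
    exact h.symm
  have h4 : f c ^ p = 1 := by
    rw [← sub_eq_zero, ← mul_geom_sum, h1, mul_zero]
  have h5 : f d ^ q = 1 := by
    rw [← sub_eq_zero, ← mul_geom_sum, h2, mul_zero]
  have h6 : f c ^ q = 1 := by
    simpa [h5] using (mul_pow (f c) (f d) q).symm.trans (by rw [h3, one_pow])
  have h7 : f c = 1 := by
    have h := orderOf_dvd_of_pow_eq_one h4
    have h' := orderOf_dvd_of_pow_eq_one h6
    exact orderOf_eq_one_iff.1 (Nat.eq_one_of_dvd_coprimes hpq h h')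
  have h8 : f d = 1 := by rwa [h7, one_mul] at h3
  have h9 : (p : R ⧸ I) = 0 := by simpa [h7] using h1
  have h10 : (q : R ⧸ I) = 0 := by simpa [h8] using h2
  have h11 : (1 : R) ∈ I := by
    rw [← Ideal.Quotient.eq_zero_iff_mem, map_one]
    have h := congrArg (Int.cast : ℤ → R ⧸ I) (Nat.gcd_eq_gcd_ab p q)
    rw [hpq.gcd_eq_one] at h
    simpa [h9, h10] using h
  obtain ⟨u, v, r, h⟩ := Submodule.mem_span_triple.1 h11
  exact ⟨u, v, r, by simpa using h⟩

open scoped IsMulCommutative in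
/-- If `a` is square-zero, commutes with `c, d`, is killed by `1 + c + ⋯ + c ^ (p - 1)` and
`1 + d + ⋯ + d ^ (q - 1)` for coprime `p, q`, and `g` conjugates `a` to `c * d * a`, then
`1 + a` lies in all terms of the lower central series of the normalized units; so `a = 0` if these
are residually nilpotent. -/
theorem eq_zero_of_isResiduallyNilpotent {G : Type*} [Group G]
    (hG : IsResiduallyNilpotent (normalizedUnits G)) {p q : ℕ} (hpq : p.Coprime q)
    {a c d : MonoidAlgebra ℤ G} {g : normalizedUnits G} (hcd : Commute c d) (hca : Commute c a)
    (hda : Commute d a) (hcg : Commute c ((g : (MonoidAlgebra ℤ G)ˣ) : MonoidAlgebra ℤ G))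
    (hdg : Commute d ((g : (MonoidAlgebra ℤ G)ˣ) : MonoidAlgebra ℤ G))
    (hε : augmentation G a = 0) (ha : a * a = 0)
    (hca0 : (∑ i ∈ Finset.range p, c ^ i) * a = 0) (hda0 : (∑ i ∈ Finset.range q, d ^ i) * a = 0)
    (hga : ((g : (MonoidAlgebra ℤ G)ˣ) : MonoidAlgebra ℤ G) * a =
      c * d * a * ((g : (MonoidAlgebra ℤ G)ˣ) : MonoidAlgebra ℤ G)) : a = 0 := by
  set R := Algebra.adjoin ℤ {c, d} with hR
  have hcomm : ∀ x ∈ ({c, d} : Set (MonoidAlgebra ℤ G)), ∀ y ∈ ({c, d} : Set (MonoidAlgebra ℤ G)),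
      x * y = y * x := by
    rintro x (rfl | rfl) y (rfl | rfl)
    exacts [rfl, hcd.eq, hcd.symm.eq, rfl]
  have hRcomm : ∀ {x}, Commute c x → Commute d x → ∀ r ∈ R, Commute r x := by
    intro x hcx hdx r hr
    refine (Algebra.commute_of_mem_adjoin_of_forall_mem_commute hr ?_).symm
    rintro b (rfl | rfl)
    exacts [hcx.symm, hdx.symm]
  have hRa : ∀ r ∈ R, Commute r a := hRcomm hca hda
  have hRg := hRcomm hcg hdg
  have hcR : c ∈ R := Algebra.subset_adjoin (by simp)
  have hdR : d ∈ R := Algebra.subset_adjoin (by simp)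
  -- Both geometric sums annihilate `a`, so `s` inverts `1 - c * d` on `a`.
  obtain ⟨s, hsR, hs⟩ : ∃ s ∈ R, s * (1 - c * d) * a = a := by
    have : IsMulCommutative R := Algebra.isMulCommutative_adjoin ℤ hcomm
    obtain ⟨u, v, r, h⟩ := exists_mul_geom_sum_add_eq_one hpq (⟨c, hcR⟩ : R) ⟨d, hdR⟩
    refine ⟨r, r.2, ?_⟩
    have h1 := congrArg (fun x : R => (x : MonoidAlgebra ℤ G) * a) h
    have h2 : ((u : MonoidAlgebra ℤ G) * (∑ i ∈ Finset.range p, c ^ i) +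
        v * (∑ i ∈ Finset.range q, d ^ i) + r * (1 - c * d)) * a = a := by
      simpa using h1
    rwa [add_mul, add_mul, mul_assoc, hca0, mul_assoc, hda0, mul_zero, mul_zero, zero_add,
      zero_add] at h2
  have hsq : ∀ r ∈ R, ∀ t ∈ R, (r * a) * (t * a) = 0 := by
    intro r _ t ht
    rw [mul_assoc, ← mul_assoc a, ← (hRa t ht).eq, mul_assoc t, ha, mul_zero, mul_zero]
  have hunit : ∀ r ∈ R, ∃ u : normalizedUnits G,
      ((u : (MonoidAlgebra ℤ G)ˣ) : MonoidAlgebra ℤ G) = 1 + r * a := by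
    intro r hr
    have h0 := hsq r hr r hr
    refine ⟨⟨⟨1 + r * a, 1 - r * a, ?_, ?_⟩, ?_⟩, rfl⟩
    · rw [mul_sub, add_mul, add_mul, h0]; simp
    · rw [mul_add, sub_mul, sub_mul, h0]; simp
    · refine MonoidHom.mem_ker.2 (Units.ext ?_)
      simp [hε]
  have key : ∀ n : ℕ, ∀ r ∈ R, ∀ u : normalizedUnits G,
      ((u : (MonoidAlgebra ℤ G)ˣ) : MonoidAlgebra ℤ G) = 1 + r * a →
      u ∈ (⊤ : Subgroup (normalizedUnits G)).lowerCentralSeries n := by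
    intro n
    induction n with
    | zero => intro r _ u _; exact Subgroup.mem_top u
    | succ n ih =>
      intro r hr u hu
      -- With `v = 1 + rsa`, `⁅v, g⁆ = (1 + rsa)(1 - rs·cd·a) = 1 + rs(1 - cd)a = 1 + ra`.
      obtain ⟨v, hv⟩ := hunit (r * s) (mul_mem hr hsR)
      have hvn := ih _ (mul_mem hr hsR) v hv
      have huv : u = ⁅v, g⁆ := by
        refine eq_mul_inv_of_mul_eq (eq_mul_inv_of_mul_eq (Subtype.ext (Units.ext ?_)))
        have hY : r * a + r * s * (c * d) * a = r * s * a := by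
          nth_rewrite 1 [← hs]
          noncomm_ring
        have hZ : r * a * (r * s * (c * d) * a) = 0 :=
          hsq r hr _ (mul_mem (mul_mem hr hsR) (mul_mem hcR hdR))
        push_cast
        rw [hu, hv, mul_assoc, mul_add, mul_one, ← mul_assoc _ (r * s) a,
          ← (hRg _ (mul_mem hr hsR)).eq, mul_assoc (r * s), hga, ← mul_assoc (r * s),
          ← mul_assoc (r * s), ← one_add_mul, ← mul_assoc, mul_add, mul_one, add_mul 1, one_mul,
          hZ, add_zero, add_assoc, hY]
      rw [huv]
      exact Subgroup.commutator_mem_commutator hvn (Subgroup.mem_top g)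
  obtain ⟨u, hu⟩ := hunit 1 (one_mem R)
  have hu1 : u ∈ nilpotentResidue (normalizedUnits G) :=
    Subgroup.mem_iInf.2 fun n => key n 1 (one_mem R) u hu
  rw [IsResiduallyNilpotent] at hG
  rw [hG, Subgroup.mem_bot] at hu1
  rw [hu1] at hu
  simpa using hu

/-! ### Nilpotency of `G` from its embedding in the units -/

/-- Group elements as normalized units. -/
noncomputable def groupToNormalizedUnits (G : Type*) [Group G] : G →* normalizedUnits G :=
  (Units.map (MonoidAlgebra.of ℤ G)).comp (toUnits : G ≃* Gˣ).toMonoidHom |>.codRestrict _ fun g =>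
    MonoidHom.mem_ker.2 (Units.ext (by simp [augmentation]))

theorem coe_groupToNormalizedUnits {G : Type*} [Group G] (g : G) :
    ((groupToNormalizedUnits G g : (MonoidAlgebra ℤ G)ˣ) : MonoidAlgebra ℤ G) =
      MonoidAlgebra.of ℤ G g := rfl

theorem groupToNormalizedUnits_injective (G : Type*) [Group G] :
    Function.Injective (groupToNormalizedUnits G) := fun _ _ h =>
  MonoidAlgebra.of_injective (R := ℤ)
    (congrArg (fun u : normalizedUnits G => ((u : (MonoidAlgebra ℤ G)ˣ) : MonoidAlgebra ℤ G)) h)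

theorem IsResiduallyNilpotent.of_injective {G H : Type*} [Group G] [Group H]
    (hH : IsResiduallyNilpotent H) (f : G →* H) (hf : Function.Injective f) :
    IsResiduallyNilpotent G := by
  rw [IsResiduallyNilpotent, nilpotentResidue, eq_bot_iff] at hH ⊢
  intro g hg
  rw [Subgroup.mem_bot, ← map_eq_one_iff f hf, ← Subgroup.mem_bot]
  refine hH (Subgroup.mem_iInf.2 fun n => ?_)
  have h1 := Subgroup.mem_map_of_mem f (Subgroup.mem_iInf.1 hg n)
  rw [Subgroup.map_lowerCentralSeries] at h1
  exact Subgroup.lowerCentralSeries_mono n le_top h1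

/-- In a finite group the lower central series stabilizes, so its intersection is one of its terms.
-/
theorem IsResiduallyNilpotent.isNilpotent {G : Type*} [Group G] [Finite G]
    (hG : IsResiduallyNilpotent G) : Group.IsNilpotent G := by
  rw [Subgroup.nilpotent_iff_lowerCentralSeries]
  obtain ⟨n, hn⟩ := WellFoundedGT.monotone_chain_condition
    (α := (Subgroup G)ᵒᵈ) ⟨_, (⊤ : Subgroup G).lowerCentralSeries_antitone.dual_right⟩
  refine ⟨n, ?_⟩
  rw [← hG, nilpotentResidue]
  refine le_antisymm (le_iInf fun m => ?_) (iInf_le _ n)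
  rcases le_total n m with h | h
  · exact (OrderDual.toDual.injective (hn m h)).le
  · exact (⊤ : Subgroup G).lowerCentralSeries_antitone h

/-! ### The obstruction from two coprime commutators -/

theorem coeff_sum_pow_of_notMem {G : Type*} [Group G] {h g : G} (hg : g ∉ Subgroup.zpowers h)
    (n : ℕ) : (∑ i ∈ Finset.range n, MonoidAlgebra.of ℤ G h ^ i).coeff g = 0 := by
  classical
  simp only [MonoidAlgebra.of_apply, MonoidAlgebra.single_pow, one_pow, MonoidAlgebra.coeff_sum,
    Finsupp.finsetSum_apply, MonoidAlgebra.coeff_single, Finsupp.single_apply]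
  refine Finset.sum_eq_zero fun i _ => if_neg ?_
  rintro rfl
  exact hg (pow_mem (Subgroup.mem_zpowers h) i)

theorem coeff_sum_pow_orderOf_one {G : Type*} [Group G] [Finite G] (h : G) :
    (∑ i ∈ Finset.range (orderOf h), MonoidAlgebra.of ℤ G h ^ i).coeff 1 = 1 := by
  classical
  simp only [MonoidAlgebra.of_apply, MonoidAlgebra.single_pow, one_pow, MonoidAlgebra.coeff_sum,
    Finsupp.finsetSum_apply, MonoidAlgebra.coeff_single, Finsupp.single_apply]
  rw [Finset.sum_eq_single 0]
  · simp
  · intro i hi hi0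
    exact if_neg (pow_ne_one_of_lt_orderOf hi0 (Finset.mem_range.1 hi))
  · intro h0
    exact absurd (Finset.mem_range.2 (orderOf_pos h)) h0

theorem pow_mul_geom_sum_of_pow_eq_one {R : Type*} [Ring R] {x : R} {n : ℕ} (hx : x ^ n = 1)
    (k : ℕ) : x ^ k * ∑ i ∈ Finset.range n, x ^ i = ∑ i ∈ Finset.range n, x ^ i := by
  have h1 : x * ∑ i ∈ Finset.range n, x ^ i = ∑ i ∈ Finset.range n, x ^ i := by
    rw [← sub_eq_zero, ← sub_one_mul, mul_geom_sum, hx, sub_self]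
  induction k with
  | zero => rw [pow_zero, one_mul]
  | succ k ih => rw [pow_succ, mul_assoc, h1, ih]

/-- Expanding gives sums over the cosets of `⟨h⟩` by `1`, `c`, `d` and `cd`; only the first contains
the identity. This certifies that the square-zero element is nonzero. -/
theorem coeff_mul_mul_sum_pow_orderOf_one {G : Type*} [Group G] [Finite G] {h c d : G}
    (hc : c ∉ Subgroup.zpowers h) (hd : d ∉ Subgroup.zpowers h)
    (hcd : c * d ∉ Subgroup.zpowers h) :
    ((1 - MonoidAlgebra.of ℤ G c) * (1 - MonoidAlgebra.of ℤ G d) *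
      ∑ i ∈ Finset.range (orderOf h), MonoidAlgebra.of ℤ G h ^ i).coeff 1 = 1 := by
  set s := ∑ i ∈ Finset.range (orderOf h), MonoidAlgebra.of ℤ G h ^ i with hs
  have key : ∀ g ∉ Subgroup.zpowers h, (MonoidAlgebra.of ℤ G g * s).coeff 1 = 0 := by
    intro g hg
    rw [MonoidAlgebra.of_apply, MonoidAlgebra.coeff_single_mul_apply, hs, coeff_sum_pow_of_notMem,
      mul_zero]
    rwa [mul_one, inv_mem_iff]
  have h1 : (1 - MonoidAlgebra.of ℤ G c) * (1 - MonoidAlgebra.of ℤ G d) * s =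
      s - MonoidAlgebra.of ℤ G c * s - MonoidAlgebra.of ℤ G d * s +
        MonoidAlgebra.of ℤ G (c * d) * s := by
    rw [map_mul]
    noncomm_ring
  rw [h1]
  simp only [MonoidAlgebra.coeff_add, MonoidAlgebra.coeff_sub, Finsupp.add_apply,
    Finsupp.sub_apply, key c hc, key d hd, key _ hcd, sub_zero, add_zero]
  exact coeff_sum_pow_orderOf_one h

/-- Two commuting commutator triples for coprime orders obstruct residual nilpotence of the
normalized units as soon as the cyclic group `⟨h⟩` avoids the commutators. -/
theorem not_isResiduallyNilpotent_of_isCommutatorTriple {G : Type*} [Group G] [Finite G]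
    {p q : ℕ} (hpq : p.Coprime q)
    {h y c z w d : G} (hP : IsCommutatorTriple p h y c) (hQ : IsCommutatorTriple q z w d)
    (hhz : Commute h z) (hhw : Commute h w) (hhd : Commute h d)
    (hyz : Commute y z) (hyd : Commute y d)
    (hcz : Commute c z) (hcw : Commute c w) (hcd : Commute c d)
    (hc : c ∉ Subgroup.zpowers h) (hd : d ∉ Subgroup.zpowers h)
    (hcdh : c * d ∉ Subgroup.zpowers h) : ¬ IsResiduallyNilpotent (normalizedUnits G) := by
  intro hG
  set f := MonoidAlgebra.of ℤ G with hf
  have hcomm : ∀ {a b : G}, Commute a b → Commute (f a) (f b) := fun h => h.map f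
  set n := orderOf h with hn
  set s := ∑ i ∈ Finset.range n, f h ^ i with hs
  set e := (1 - f c) * (1 - f d) with he
  have hsum : ∀ {b x : MonoidAlgebra ℤ G} (k : ℕ), Commute b x →
      Commute (∑ i ∈ Finset.range k, b ^ i) x := fun k h1 =>
    Commute.sum_left _ _ _ fun i _ => h1.pow_left i
  have hee : ∀ {x}, Commute (f c) x → Commute (f d) x → Commute e x := fun h1 h2 =>
    ((Commute.one_left _).sub_left h1).mul_left ((Commute.one_left _).sub_left h2)
  have hce : Commute (f c) e := (hee (Commute.refl _) (hcomm hcd.symm)).symm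
  have hde : Commute (f d) e := (hee (hcomm hcd) (Commute.refl _)).symm
  have hcs : Commute (f c) s := (hsum n (hcomm hP.left.symm)).symm
  have hds : Commute (f d) s := (hsum n (hcomm hhd)).symm
  have hcn : c ^ n = 1 := by
    have h1 := pow_mul_eq_mul_mul_pow hP.eq n
    rw [hP.left.symm.mul_pow, pow_orderOf_eq_one, one_mul, one_mul] at h1
    exact left_eq_mul.1 h1
  have hce0 : ∀ k, c ^ k = 1 → (∑ i ∈ Finset.range k, f c ^ i) * e = 0 := fun k hk => by
    rw [he, ← mul_assoc, geom_sum_mul_neg, ← map_pow, hk, map_one, sub_self, zero_mul]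
  have hde0 : (∑ i ∈ Finset.range q, f d ^ i) * e = 0 := by
    have h1 : e = (1 - f d) * (1 - f c) :=
      (((Commute.one_left _).sub_left ((Commute.one_right _).sub_right (hcomm hcd)))).eq
    rw [h1, ← mul_assoc, geom_sum_mul_neg, ← map_pow, ← hQ.order, pow_orderOf_eq_one, map_one,
      sub_self, zero_mul]
  set t := ∑ i ∈ Finset.range n, (f h * f c) ^ i with ht
  have hsy : s * f y = f y * t := by
    rw [hs, Finset.sum_mul, Finset.mul_sum]
    refine Finset.sum_congr rfl fun i _ => pow_mul_eq_mul_mul_pow ?_ i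
    rw [← map_mul, hP.eq, map_mul, map_mul]
  have hts : t * s = (∑ i ∈ Finset.range n, f c ^ i) * s := by
    rw [Finset.sum_mul, Finset.sum_mul]
    refine Finset.sum_congr rfl fun i _ => ?_
    rw [(hcomm hP.left).symm.mul_pow, ((hcomm hP.left).pow_pow i i).symm.eq, mul_assoc,
      pow_mul_geom_sum_of_pow_eq_one (by rw [← map_pow, pow_orderOf_eq_one, map_one])]
  have htw : Commute t (f w) := hsum n ((hcomm hhw).mul_left (hcomm hcw))
  have hte : Commute t e := (hee ((hcomm hP.left).mul_right (Commute.refl _))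
    ((hcomm hhd.symm).mul_right (hcomm hcd.symm)) |> fun h1 => (hsum n h1.symm))
  set a := f y * f w * e * s with ha
  have hca : Commute (f c) a :=
    (((hcomm hP.right).mul_right (hcomm hcw)).mul_right hce).mul_right hcs
  have hda : Commute (f d) a :=
    (((hcomm hyd.symm).mul_right (hcomm hQ.right)).mul_right hde).mul_right hds
  have ha0 : a = 0 := by
    refine eq_zero_of_isResiduallyNilpotent hG hpq (c := f c) (d := f d)
      (g := groupToNormalizedUnits G (h * z)) (hcomm hcd) hca hda
      (hcomm (hP.left.mul_right hcz)) (hcomm (hhd.symm.mul_right hQ.left)) ?_ ?_ ?_ ?_ ?_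
    · simp [ha, he, hf, augmentation]
    -- Moving the inner `y` past `s` turns `s` into `t`, and `t * s` contains the factor `∑ c ^ i`
    -- over `i < n`, which `1 - c` kills because `c ^ n = 1`.
    · calc a * a = f y * f w * e * (s * f y) * f w * e * s := by simp only [ha, mul_assoc]
        _ = f y * f w * e * f y * (t * f w) * e * s := by rw [hsy]; simp only [mul_assoc]
        _ = f y * f w * e * f y * f w * (t * e) * s := by rw [htw.eq]; simp only [mul_assoc]
        _ = f y * f w * e * f y * f w * e * (t * s) := by rw [hte.eq]; simp only [mul_assoc]
        _ = f y * f w * e * f y * f w * (e * ∑ i ∈ Finset.range n, f c ^ i) * s := by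
          rw [hts]; simp only [mul_assoc]
        _ = 0 := by rw [← (hsum n hce).eq, hce0 n hcn]; simp
    · have h1 := hsum p ((hcomm hP.right).mul_right (hcomm hcw))
      rw [ha, ← mul_assoc, ← mul_assoc, h1.eq, mul_assoc (f y * f w),
        hce0 p (hP.order ▸ pow_orderOf_eq_one c), mul_zero, zero_mul]
    · have h1 := hsum q ((hcomm hyd.symm).mul_right (hcomm hQ.right))
      rw [ha, ← mul_assoc, ← mul_assoc, h1.eq, mul_assoc (f y * f w), hde0, mul_zero, zero_mul]
    · rw [coe_groupToNormalizedUnits]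
      have h1 : h * z * (y * w) = c * d * (y * w) * (h * z) := by
        calc h * z * (y * w) = h * (z * y) * w := by simp only [mul_assoc]
          _ = h * y * (z * w) := by rw [hyz.symm.eq]; simp only [mul_assoc]
          _ = y * (h * w) * z * (c * d) := by
            rw [hP.eq, hQ.eq, mul_assoc (y * h), mul_assoc w, ← mul_assoc c, hcw.eq,
              mul_assoc w c, ← mul_assoc c, hcz.eq]
            simp only [mul_assoc]
          _ = y * w * (h * z) * (c * d) := by rw [hhw.eq]; simp only [mul_assoc]
          _ = c * d * (y * w) * (h * z) := by
            have h2 : Commute (c * d) (y * w * (h * z)) :=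
              (((hP.right.mul_left hyd.symm).mul_right (hcw.mul_left hQ.right))).mul_right
                ((hP.left.mul_left hhd.symm).mul_right (hcz.mul_left hQ.left))
            rw [← h2.eq]
            simp only [mul_assoc]
      have h2 : Commute (f (h * z)) (e * s) :=
        ((hee (hcomm (hP.left.mul_right hcz)) (hcomm (hhd.symm.mul_right hQ.left))).mul_left
          (hsum n (hcomm ((Commute.refl h).mul_right hhz)))).symm
      rw [ha, mul_assoc (f y * f w), ← map_mul f y w, ← mul_assoc, ← map_mul f _ (y * w), h1,
        mul_assoc (f c * f d), mul_assoc (f (y * w)), ← h2.eq]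
      simp only [map_mul, mul_assoc]
  have hes : e * s = 0 := by
    have h1 : f w⁻¹ * f y⁻¹ * a = e * s := by
      rw [ha, mul_assoc _ e s, ← mul_assoc, ← map_mul, ← map_mul, ← map_mul]
      simp [mul_assoc]
    rw [← h1, ha0, mul_zero]
  have h1 : (e * s).coeff 1 = 1 := coeff_mul_mul_sum_pow_orderOf_one hc hd hcdh
  rw [hes] at h1
  simp at h1

/-! ### Conclusion -/

theorem isPAbelian_of_isResiduallyNilpotent {G : Type*} [Group G] [Finite G]
    [Group.IsNilpotent G] (hG : IsResiduallyNilpotent (normalizedUnits G)) : IsPAbelian G := by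
  by_contra hne
  have hcard : Nat.card (commutator G) ≠ 0 := Nat.card_pos.ne'
  have key : ∀ p : ℕ, p.Prime → ∃ q, q.Prime ∧ q ∣ Nat.card (commutator G) ∧ q ≠ p := by
    intro p hp
    by_contra! h
    have := Fact.mk hp
    refine hne ⟨p, hp, IsPGroup.iff_card.2 ⟨_, Nat.eq_prime_pow_of_unique_prime_dvd hcard ?_⟩⟩
    exact fun hq hqd => h _ hq hqd
  -- Avoiding `2` first makes `p` odd, as the descent for `c ∉ ⟨h⟩` requires; `q` may be `2`.
  obtain ⟨p, hp, hpd, hp2⟩ := key 2 Nat.prime_two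
  obtain ⟨q, hq, hqd, hqp⟩ := key p hp
  have := Fact.mk hp
  have := Fact.mk hq
  obtain ⟨P⟩ : Nonempty (Sylow p G) := inferInstance
  obtain ⟨Q⟩ : Nonempty (Sylow q G) := inferInstance
  obtain ⟨h, y, c, hP, hc⟩ := exists_isCommutatorTriple_notMem_zpowers hp hp2 P.isPGroup'
    (P.not_comm_of_dvd_card_commutator hpd)
  obtain ⟨z, w, d, hQ⟩ := exists_isCommutatorTriple hq Q.isPGroup'
    (Q.not_comm_of_dvd_card_commutator hqd)
  have hdisj : Disjoint (P : Subgroup G) Q :=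
    IsPGroup.disjoint_of_ne p q hqp.symm _ _ P.isPGroup' Q.isPGroup'
  have hPQ : ∀ (a : P) (b : Q), Commute (a : G) b := fun a b =>
    Subgroup.commute_of_normal_of_disjoint _ _ inferInstance inferInstance hdisj _ _ a.2 b.2
  have hP' : IsCommutatorTriple p (h : G) y c :=
    ⟨congrArg Subtype.val hP.eq, congrArg Subtype.val hP.left, congrArg Subtype.val hP.right,
      by rw [Subgroup.orderOf_coe, hP.order]⟩
  have hQ' : IsCommutatorTriple q (z : G) w d :=
    ⟨congrArg Subtype.val hQ.eq, congrArg Subtype.val hQ.left, congrArg Subtype.val hQ.right,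
      by rw [Subgroup.orderOf_coe, hQ.order]⟩
  have hle : Subgroup.zpowers (h : G) ≤ P := by
    rw [Subgroup.zpowers_le]
    exact h.2
  have hd : (d : G) ∉ (P : Subgroup G) := by
    intro hdP
    have h1 : (d : G) = 1 := Subgroup.disjoint_def.1 hdisj hdP d.2
    have h2 := hQ'.order
    rw [h1, orderOf_one] at h2
    exact hq.one_lt.ne h2
  refine not_isResiduallyNilpotent_of_isCommutatorTriple ((Nat.coprime_primes hp hq).2 hqp.symm)
    hP' hQ' (hPQ _ _) (hPQ _ _) (hPQ _ _) (hPQ _ _) (hPQ _ _) (hPQ _ _) (hPQ _ _) (hPQ _ _)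
    ?_ (fun h => hd (hle h)) (fun h => hd ?_) hG
  · rintro ⟨k, hk⟩
    exact hc ⟨k, Subtype.ext (by simpa using hk)⟩
  · exact (Subgroup.mul_mem_cancel_left _ c.2).1 (hle h)

theorem mainTheorem2 (G : Type*) [Group G] [Finite G] :
    List.TFAE [
      lieAugmentationResidue G = ⊥,
      IsResiduallyNilpotent (normalizedUnits G),
      Group.IsNilpotent G ∧ IsPAbelian G] := by
  tfae_have 1 → 2 := isResiduallyNilpotent_normalizedUnits
  tfae_have 2 → 3 := by
    intro h
    have := (h.of_injective _ (groupToNormalizedUnits_injective G)).isNilpotent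
    exact ⟨this, isPAbelian_of_isResiduallyNilpotent h⟩
  tfae_have 3 → 1 := by
    rintro ⟨_, p, hp, hG⟩
    exact lieAugmentationResidue_eq_bot hp G hG
  tfae_finish
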